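/- \textbf{Setting (affine continuous logic).} A Lipschitz language $L$ is a set of constant, function and relation symbols; each function or relation symbol has an arity $n\ge 1$ and a Lipschitz constant $\lambda\ge 0$. An $L$-structure $M$ is a nonempty complete metric space $(M,d)$ of diameter at most $1$ together with an element $c^M\in M$ for each constant symbol $c$, a $\lambda_F$-Lipschitz map $F^M:M^n\to M$ for each $n$-ary function symbol $F$, and a $\lambda_R$-Lipschitz map $R^M:M^n\to[0,1]$ for each $n$-ary relation symbol $R$, where $M^n$ carries the metric $\sum_{i=1}^n d(x_i,y_i)$. Terms are built from variables and constant symbols by function symbols. Formulas are built from the atomic formulas $1$, $d(t_1,t_2)$ and $R(t_1,\dots,t_n)$ by addition $\phi+\psi$, multiplication $r\phi$ by real numbers $r$, and the quantifiers $\inf_x\phi$ and $\sup_x\phi$; they are interpreted in $M$ as real-valued functions in the obvious way. A sentence is a formula without free variables; for a sentence $\sigma$, $\sigma^M\in\mathbb{R}$ is its value in $M$, and for $r\in\mathbb{R}$, $\sigma-r$ denotes the sentence $\sigma+(-r)1$. One writes $\vDash\sigma\leqslant\tau$ if $\sigma^M\leqslant\tau^M$ for every structure $M$ in a language containing the symbols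 of $\sigma$ and $\tau$. \textbf{Proposition (Affine Craig interpolation).} Let $L_1$ and $L_2$ be Lipschitz languages whose common symbols have the same kind, arity and Lipschitz constant in both. Let $\phi$ be an $L_1$-sentence and $\psi$ an $L_2$-sentence such that $\phi^M\leqslant\psi^M$ for every $(L_1\cup L_2)$-structure $M$. Then for each real $\epsilon>0$ there is an $(L_1\cap L_2)$-sentence $\theta$ such that $$\vDash\phi-\epsilon\leqslant\theta\leqslant\psi,$$ that is, $\phi^M-\epsilon\leqslant\theta^M$ for every $L_1$-structure $M$ and $\theta^N\leqslant\psi^N$ for every $L_2$-structure $N$. -/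

import Mathlib

universe u

namespace AffineLogic

/-- A Lipschitz language: constant, function and relation symbols; every function and relation
symbol has an arity at least `1` and a Lipschitz constant. The metric symbol `d` is a logical symbol
and belongs to every language. -/
structure LipLanguage where
  Const : Type u
  Func : Type u
  Rel : Type u
  funcArity : Func → ℕ
  relArity : Rel → ℕ
  funcArity_pos : ∀ F, 1 ≤ funcArity F
  relArity_pos : ∀ R, 1 ≤ relArity R
  funcLip : Func → NNReal
  relLip : Rel → NNReal

/-- Terms whose variables are among `x₀, …, xₙ₋₁`. -/
inductive Term (L : LipLanguage.{u}) (n : ℕ) : Type u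
  | var (i : Fin n) : Term L n
  | const (c : L.Const) : Term L n
  | func (F : L.Func) (ts : Fin (L.funcArity F) → Term L n) : Term L n

/-- Formulas of affine continuous logic whose free variables are among `x₀, …, xₙ₋₁`.
The quantifiers `inf` and `sup` bind the last variable `xₙ` of their argument. -/
inductive Formula (L : LipLanguage.{u}) : ℕ → Type u
  | one {n : ℕ} : Formula L n
  | dist {n : ℕ} (t₁ t₂ : Term L n) : Formula L n
  | rel {n : ℕ} (R : L.Rel) (ts : Fin (L.relArity R) → Term L n) : Formula L n
  | add {n : ℕ} (φ ψ : Formula L n) : Formula L n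
  | smul {n : ℕ} (r : ℝ) (φ : Formula L n) : Formula L n
  | inf {n : ℕ} (φ : Formula L (n + 1)) : Formula L n
  | sup {n : ℕ} (φ : Formula L (n + 1)) : Formula L n

/-- Sentences are formulas without free variables. -/
abbrev Sentence (L : LipLanguage.{u}) : Type u := Formula L 0

/-- `φ - r`, that is, the formula `φ + (-r)·1`. -/
def Formula.subConst {L : LipLanguage.{u}} {n : ℕ} (φ : Formula L n) (r : ℝ) : Formula L n :=
  .add φ (.smul (-r) .one)

/-- An `L`-structure: a nonempty complete metric space of diameter at most `1` with
interpretations of the symbols of `L` that are Lipschitz, with the constants prescribed by `L`,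
for the sum metric on finite powers; relations take values in `[0, 1]`. -/
structure Model (L : LipLanguage.{u}) where
  carrier : Type u
  [metric : MetricSpace carrier]
  [complete : CompleteSpace carrier]
  [nonempty : Nonempty carrier]
  dist_le_one : ∀ a b : carrier, dist a b ≤ 1
  const : L.Const → carrier
  func : ∀ F : L.Func, (Fin (L.funcArity F) → carrier) → carrier
  func_lip : ∀ (F : L.Func) (a b : Fin (L.funcArity F) → carrier),
    dist (func F a) (func F b) ≤ L.funcLip F * ∑ i, dist (a i) (b i)
  rel : ∀ R : L.Rel, (Fin (L.relArity R) → carrier) → ℝ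
  rel_mem : ∀ (R : L.Rel) (a : Fin (L.relArity R) → carrier), rel R a ∈ Set.Icc (0 : ℝ) 1
  rel_lip : ∀ (R : L.Rel) (a b : Fin (L.relArity R) → carrier),
    rel R a - rel R b ≤ L.relLip R * ∑ i, dist (a i) (b i)

attribute [instance] Model.metric Model.complete Model.nonempty

/-- The value of a term in a structure. -/
def Term.value {L : LipLanguage.{u}} (M : Model L) {n : ℕ} (a : Fin n → M.carrier) :
    Term L n → M.carrier
  | .var i => a i
  | .const c => M.const c
  | .func F ts => M.func F (fun i => (ts i).value M a)

/-- The value of a formula in a structure. -/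
noncomputable def Formula.value {L : LipLanguage.{u}} (M : Model L) :
    {n : ℕ} → Formula L n → (Fin n → M.carrier) → ℝ
  | _, .one, _ => 1
  | _, .dist t₁ t₂, a => Dist.dist (t₁.value M a) (t₂.value M a)
  | _, .rel R ts, a => M.rel R (fun i => (ts i).value M a)
  | _, .add φ ψ, a => φ.value M a + ψ.value M a
  | _, .smul r φ, a => r * φ.value M a
  | _, .inf φ, a => ⨅ b : M.carrier, φ.value M (Fin.snoc a b)
  | _, .sup φ, a => ⨆ b : M.carrier, φ.value M (Fin.snoc a b)

/-- The bound of a formula. -/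
def Formula.bound {L : LipLanguage.{u}} : {n : ℕ} → Formula L n → ℝ
  | _, .one => 1
  | _, .dist _ _ => 1
  | _, .rel _ _ => 1
  | _, .add φ ψ => φ.bound + ψ.bound
  | _, .smul r φ => |r| * φ.bound
  | _, .inf φ => φ.bound
  | _, .sup φ => φ.bound

/-- The values of a formula are bounded, so the infima and suprema in `Formula.value` are genuine
infima and suprema of nonempty bounded sets of reals. -/
theorem Formula.abs_value_le {L : LipLanguage.{u}} (M : Model L) {n : ℕ} (φ : Formula L n)
    (a : Fin n → M.carrier) : |φ.value M a| ≤ φ.bound := by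
  induction φ with
  | one => simp [Formula.value, Formula.bound]
  | dist t₁ t₂ =>
    simpa [Formula.value, Formula.bound, abs_of_nonneg dist_nonneg] using M.dist_le_one _ _
  | rel R ts =>
    have h := M.rel_mem R (fun i => (ts i).value M a)
    simpa [Formula.value, Formula.bound, abs_of_nonneg h.1] using h.2
  | add φ ψ h₁ h₂ => exact (abs_add_le _ _).trans (add_le_add (h₁ a) (h₂ a))
  | smul r φ h =>
    simp only [Formula.value, Formula.bound, abs_mul]
    exact mul_le_mul_of_nonneg_left (h a) (abs_nonneg r)
  | inf φ h =>
    have h' := fun b => abs_le.1 (h (Fin.snoc a b))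
    refine abs_le.2 ⟨le_ciInf fun b => (h' b).1, ?_⟩
    exact (ciInf_le ⟨-φ.bound, by rintro _ ⟨b, rfl⟩; exact (h' b).1⟩
      (Classical.arbitrary _)).trans (h' _).2
  | sup φ h =>
    have h' := fun b => abs_le.1 (h (Fin.snoc a b))
    refine abs_le.2 ⟨?_, ciSup_le fun b => (h' b).2⟩
    exact (h' (Classical.arbitrary _)).1.trans
      (le_ciSup (f := fun b => φ.value M (Fin.snoc a b))
        ⟨φ.bound, by rintro _ ⟨b, rfl⟩; exact (h' b).2⟩ _)

/-- The value of a sentence in a structure. -/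
noncomputable def Sentence.val {L : LipLanguage.{u}} (M : Model L) (σ : Sentence L) : ℝ :=
  Formula.value M σ Fin.elim0

/-- `⊨ σ ≤ τ`: the closed condition `σ ≤ τ` holds in every `L`-structure. -/
def ValidLe {L : LipLanguage.{u}} (σ τ : Sentence L) : Prop :=
  ∀ M : Model L, Sentence.val M σ ≤ Sentence.val M τ

/-- A set of symbols of `S`. Two languages whose common symbols have the same arities
and Lipschitz constants are two sets of symbols of their union. -/
@[ext] structure Sublanguage (S : LipLanguage.{u}) where
  consts : Set S.Const
  funcs : Set S.Func
  rels : Set S.Rel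

namespace Sublanguage

variable {S : LipLanguage.{u}}

/-- The language consisting of the symbols in `L`, with their arities and Lipschitz constants. -/
def toLang (L : Sublanguage S) : LipLanguage.{u} where
  Const := L.consts
  Func := L.funcs
  Rel := L.rels
  funcArity F := S.funcArity F
  relArity R := S.relArity R
  funcArity_pos F := S.funcArity_pos F
  relArity_pos R := S.relArity_pos R
  funcLip F := S.funcLip F
  relLip R := S.relLip R

/-- Inclusion of languages. -/
protected structure Subset (L L' : Sublanguage S) : Prop where
  consts : L.consts ⊆ L'.consts
  funcs : L.funcs ⊆ L'.funcs
  rels : L.rels ⊆ L'.rels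

instance : HasSubset (Sublanguage S) := ⟨Sublanguage.Subset⟩

instance : Inter (Sublanguage S) :=
  ⟨fun L L' => ⟨L.consts ∩ L'.consts, L.funcs ∩ L'.funcs, L.rels ∩ L'.rels⟩⟩

instance : Union (Sublanguage S) :=
  ⟨fun L L' => ⟨L.consts ∪ L'.consts, L.funcs ∪ L'.funcs, L.rels ∪ L'.rels⟩⟩

theorem inter_subset_left (L L' : Sublanguage S) : L ∩ L' ⊆ L :=
  ⟨Set.inter_subset_left, Set.inter_subset_left, Set.inter_subset_left⟩

theorem inter_subset_right (L L' : Sublanguage S) : L ∩ L' ⊆ L' :=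
  ⟨Set.inter_subset_right, Set.inter_subset_right, Set.inter_subset_right⟩

theorem subset_union_left (L L' : Sublanguage S) : L ⊆ L ∪ L' :=
  ⟨Set.subset_union_left, Set.subset_union_left, Set.subset_union_left⟩

theorem subset_union_right (L L' : Sublanguage S) : L' ⊆ L ∪ L' :=
  ⟨Set.subset_union_right, Set.subset_union_right, Set.subset_union_right⟩

end Sublanguage

/-- If `L ⊆ L'`, then every `L`-term is an `L'`-term. -/
def Term.incl {S : LipLanguage.{u}} {L L' : Sublanguage S} (h : L ⊆ L') {n : ℕ} :
    Term L.toLang n → Term L'.toLang n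
  | .var i => .var i
  | .const c => .const (L := L'.toLang) ⟨c.1, h.consts c.2⟩
  | .func F ts => .func (L := L'.toLang) ⟨F.1, h.funcs F.2⟩ (fun i => (ts i).incl h)

/-- If `L ⊆ L'`, then every `L`-formula is an `L'`-formula. -/
def Formula.incl {S : LipLanguage.{u}} {L L' : Sublanguage S} (h : L ⊆ L') :
    {n : ℕ} → Formula L.toLang n → Formula L'.toLang n
  | _, .one => .one
  | _, .dist t₁ t₂ => .dist (t₁.incl h) (t₂.incl h)
  | _, .rel R ts => .rel (L := L'.toLang) ⟨R.1, h.rels R.2⟩ (fun i => (ts i).incl h)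
  | _, .add φ ψ => .add (φ.incl h) (ψ.incl h)
  | _, .smul r φ => .smul r (φ.incl h)
  | _, .inf φ => .inf (φ.incl h)
  | _, .sup φ => .sup (φ.incl h)

end AffineLogic

/-! Interpolation is a separation argument. A `Name` is a formal element: a constant, a function
symbol applied to names, or an approximate witness for an infimum in one of the two languages. A
`Point` on side `b` is an `Ls b`-structure with an assignment that fixes the names foreign to `Ls
b`; the other names are then evaluated. A common-language formula applied to names gives a pair of
bounded functions, one on the points of each side, and these pairs form a linear space `D`.

Suppose an element of `D` lies above `φ - ε` on the first side and below `ψ` on the second. Its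
names are eliminated one by one, largest first: a name foreign to the second language is bound by
`sup`, one foreign to the first by `inf`, and a name headed by a common symbol is replaced by a term
in smaller names. What remains is the interpolant (`exists_definable_erase`,
`exists_sentence_of_definable`).

Otherwise the Riesz extension theorem gives finitely additive means on the two sides that agree on
`D`, with the mean of `ψ` at most the mean of `φ - ε` (`exists_isMean_pair`). Averaging distances
and relations makes the names a pre-structure for the union language. In its completion each `Ls
b`-formula takes the mean of its values: affine connectives commute with means, and the witness
names handle quantifiers (`valueEqMean`). This structure violates `φ ≤ ψ`. -/

namespace AffineLogic

/-! ### Substitution of terms -/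

section Substitution

variable {L : LipLanguage.{u}}

/-- Simultaneous substitution of terms for the variables of a term. -/
def Term.subst {n m : ℕ} (σ : Fin n → Term L m) : Term L n → Term L m
  | .var i => σ i
  | .const c => .const c
  | .func F ts => .func F (fun i => (ts i).subst σ)

theorem Term.value_subst (M : Model L) {n m : ℕ} (σ : Fin n → Term L m) (a : Fin m → M.carrier)
    (t : Term L n) : (t.subst σ).value M a = t.value M (fun i => (σ i).value M a) := by
  induction t with
  | var i => rfl
  | const c => rfl
  | func F ts ih => simp only [Term.subst, Term.value, ih]

/-- The extension of a substitution to one more variable, which is left alone. -/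
def liftSubst {n m : ℕ} (σ : Fin n → Term L m) : Fin (n + 1) → Term L (m + 1) :=
  Fin.snoc (α := fun _ => Term L (m + 1)) (fun i => (σ i).subst (fun j => .var j.castSucc))
    (.var (Fin.last m))

theorem value_liftSubst (M : Model L) {n m : ℕ} (σ : Fin n → Term L m) (a : Fin m → M.carrier)
    (b : M.carrier) :
    (fun i => (liftSubst σ i).value M (Fin.snoc (α := fun _ => M.carrier) a b)) =
      Fin.snoc (α := fun _ => M.carrier) (fun i => (σ i).value M a) b := by
  funext i
  induction i using Fin.lastCases with
  | last => simp [liftSubst, Term.value]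
  | cast i => simp [liftSubst, Term.value_subst, Term.value]

/-- Simultaneous substitution of terms for the free variables of a formula. -/
def Formula.subst : {n m : ℕ} → (Fin n → Term L m) → Formula L n → Formula L m
  | _, _, _, .one => .one
  | _, _, σ, .dist t₁ t₂ => .dist (t₁.subst σ) (t₂.subst σ)
  | _, _, σ, .rel R ts => .rel R (fun i => (ts i).subst σ)
  | _, _, σ, .add φ ψ => .add (φ.subst σ) (ψ.subst σ)
  | _, _, σ, .smul r φ => .smul r (φ.subst σ)
  | _, _, σ, .inf φ => .inf (φ.subst (liftSubst σ))
  | _, _, σ, .sup φ => .sup (φ.subst (liftSubst σ))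

theorem Formula.value_subst (M : Model L) {n m : ℕ} (σ : Fin n → Term L m) (φ : Formula L n)
    (a : Fin m → M.carrier) :
    (φ.subst σ).value M a = φ.value M (fun i => (σ i).value M a) := by
  induction φ generalizing m with
  | one => rfl
  | dist t₁ t₂ => simp only [Formula.subst, Formula.value, Term.value_subst]
  | rel R ts => simp only [Formula.subst, Formula.value, Term.value_subst]
  | add φ ψ h₁ h₂ => simp only [Formula.subst, Formula.value, h₁, h₂]
  | smul r φ h => simp only [Formula.subst, Formula.value, h]
  | inf φ h => simp only [Formula.subst, Formula.value, h, value_liftSubst]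
  | sup φ h => simp only [Formula.subst, Formula.value, h, value_liftSubst]

end Substitution

/-! ### Continuity of formulas -/

section Lipschitz

variable {L : LipLanguage.{u}} (M : Model L)

theorem sum_dist_le {X : Type*} [PseudoMetricSpace X] {k : ℕ} (a b : Fin k → X) :
    ∑ i, dist (a i) (b i) ≤ k * dist a b := by
  simpa using Finset.sum_le_sum fun i (_ : i ∈ Finset.univ) => dist_le_pi_dist a b i

theorem dist_snoc_le {X : Type*} [PseudoMetricSpace X] {k : ℕ} (a a' : Fin k → X) (b : X) :
    dist (Fin.snoc (α := fun _ => X) a b) (Fin.snoc (α := fun _ => X) a' b) ≤ dist a a' := by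
  refine (dist_pi_le_iff dist_nonneg).2 fun i => ?_
  induction i using Fin.lastCases with
  | last => simp
  | cast i => simpa using dist_le_pi_dist a a' i

theorem Term.exists_lipschitz {n : ℕ} (t : Term L n) :
    ∃ C : ℝ, 0 ≤ C ∧ ∀ a a', dist (t.value M a) (t.value M a') ≤ C * dist a a' := by
  induction t with
  | var i => exact ⟨1, zero_le_one, fun a a' => by
      simpa [Term.value] using dist_le_pi_dist a a' i⟩
  | const c => exact ⟨0, le_rfl, fun a a' => by simp [Term.value]⟩
  | func F ts ih =>
    choose C hC h using ih
    refine ⟨L.funcLip F * ∑ i, C i, mul_nonneg (NNReal.coe_nonneg _)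
      (Finset.sum_nonneg fun i _ => hC i), fun a a' => ?_⟩
    refine (M.func_lip F _ _).trans ?_
    rw [mul_assoc, Finset.sum_mul]
    exact mul_le_mul_of_nonneg_left (Finset.sum_le_sum fun i _ => h i a a') (NNReal.coe_nonneg _)

theorem Formula.bddBelow_range {ι : Type*} {n : ℕ} (φ : Formula L n) (a : ι → Fin n → M.carrier) :
    BddBelow (Set.range fun i => φ.value M (a i)) :=
  ⟨-φ.bound, by rintro _ ⟨b, rfl⟩; exact (abs_le.1 (φ.abs_value_le M _)).1⟩

theorem Formula.bddAbove_range {ι : Type*} {n : ℕ} (φ : Formula L n) (a : ι → Fin n → M.carrier) :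
    BddAbove (Set.range fun i => φ.value M (a i)) :=
  ⟨φ.bound, by rintro _ ⟨b, rfl⟩; exact (abs_le.1 (φ.abs_value_le M _)).2⟩

/-- Needed only for continuity, which lets infima be taken over a dense set; the constant may
therefore depend on `M`. -/
theorem Formula.exists_lipschitz {n : ℕ} (φ : Formula L n) :
    ∃ C : ℝ, 0 ≤ C ∧ ∀ a a', φ.value M a ≤ φ.value M a' + C * Dist.dist a a' := by
  induction φ with
  | one => exact ⟨0, le_rfl, fun a a' => by simp [Formula.value]⟩
  | dist t₁ t₂ =>
    obtain ⟨C₁, h₁, H₁⟩ := t₁.exists_lipschitz M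
    obtain ⟨C₂, h₂, H₂⟩ := t₂.exists_lipschitz M
    refine ⟨C₁ + C₂, add_nonneg h₁ h₂, fun a a' => ?_⟩
    have := dist_triangle4 (t₁.value M a) (t₁.value M a') (t₂.value M a') (t₂.value M a)
    have := H₁ a a'
    have := H₂ a' a
    rw [dist_comm a' a] at this
    simp only [Formula.value]
    linarith
  | rel R ts =>
    choose C hC h using fun i => (ts i).exists_lipschitz M
    refine ⟨L.relLip R * ∑ i, C i, mul_nonneg (NNReal.coe_nonneg _)
      (Finset.sum_nonneg fun i _ => hC i), fun a a' => ?_⟩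
    rw [← sub_le_iff_le_add']
    refine (M.rel_lip R _ _).trans ?_
    rw [mul_assoc, Finset.sum_mul]
    exact mul_le_mul_of_nonneg_left (Finset.sum_le_sum fun i _ => h i a a') (NNReal.coe_nonneg _)
  | add φ ψ h₁ h₂ =>
    obtain ⟨C₁, h₁, H₁⟩ := h₁
    obtain ⟨C₂, h₂, H₂⟩ := h₂
    refine ⟨C₁ + C₂, add_nonneg h₁ h₂, fun a a' => ?_⟩
    have := H₁ a a'
    have := H₂ a a'
    simp only [Formula.value]
    linarith
  | smul r φ h =>
    obtain ⟨C, hC, H⟩ := h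
    refine ⟨|r| * C, by positivity, fun a a' => ?_⟩
    -- Since `r` may be negative, the bound is needed in both directions.
    have h₁ := H a a'
    have h₂ := H a' a
    rw [dist_comm a' a] at h₂
    have h₃ : |φ.value M a - φ.value M a'| ≤ C * Dist.dist a a' :=
      abs_sub_le_iff.2 ⟨by linarith, by linarith⟩
    have h₄ := (le_abs_self (r * (φ.value M a - φ.value M a'))).trans_eq (abs_mul _ _)
    have h₅ := mul_le_mul_of_nonneg_left h₃ (abs_nonneg r)
    simp only [Formula.value]
    linarith
  | inf φ h =>
    obtain ⟨C, hC, H⟩ := h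
    refine ⟨C, hC, fun a a' => ?_⟩
    simp only [Formula.value]
    rw [← sub_le_iff_le_add]
    refine le_ciInf fun b => ?_
    have h₁ := ciInf_le (φ.bddBelow_range M fun b => Fin.snoc a b) b
    have h₂ := H (Fin.snoc a b) (Fin.snoc a' b)
    have h₃ := mul_le_mul_of_nonneg_left (dist_snoc_le a a' b) hC
    linarith
  | sup φ h =>
    obtain ⟨C, hC, H⟩ := h
    refine ⟨C, hC, fun a a' => ?_⟩
    simp only [Formula.value]
    refine ciSup_le fun b => ?_
    have h₁ := le_ciSup (φ.bddAbove_range M fun b => Fin.snoc a' b) b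
    have h₂ := H (Fin.snoc a b) (Fin.snoc a' b)
    have h₃ := mul_le_mul_of_nonneg_left (dist_snoc_le a a' b) hC
    linarith

theorem Formula.continuous_value {n : ℕ} (φ : Formula L n) : Continuous (φ.value M) := by
  obtain ⟨C, hC, H⟩ := φ.exists_lipschitz M
  refine (LipschitzWith.of_le_add_mul ⟨C, hC⟩ fun a a' => H a a').continuous

theorem continuous_snoc {X : Type*} [TopologicalSpace X] {n : ℕ} (a : Fin n → X) :
    Continuous fun b => (Fin.snoc (α := fun _ => X) a b : Fin (n + 1) → X) := by
  refine continuous_pi fun i => ?_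
  induction i using Fin.lastCases with
  | last => simpa using continuous_id'
  | cast i => simpa using continuous_const

end Lipschitz

/-! ### Completion of a pre-structure -/

section Completion

open UniformSpace

/-- A uniformly continuous map on a dense subspace extends to the whole space, and the Lipschitz
inequality is a closed condition that passes to the closure. The constant for the sum metric is kept
exactly. -/
theorem exists_lipschitz_extension {X Y : Type*} [PseudoMetricSpace X] [MetricSpace Y]
    [CompleteSpace Y] {k : ℕ} (f : (Fin k → X) → Y) (C : NNReal)
    (hf : ∀ a b, dist (f a) (f b) ≤ C * ∑ i, dist (a i) (b i)) :
    ∃ g : (Fin k → Completion X) → Y, (∀ a : Fin k → X, g (fun i => (a i : Completion X)) = f a) ∧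
      ∀ a b, dist (g a) (g b) ≤ C * ∑ i, dist (a i) (b i) := by
  have hlip : LipschitzWith (C * k) f := LipschitzWith.of_dist_le_mul fun a b => by
    refine (hf a b).trans ?_
    push_cast
    rw [mul_assoc]
    exact mul_le_mul_of_nonneg_left (sum_dist_le a b) C.2
  have hdense : DenseRange (fun (a : Fin k → X) i => (a i : Completion X)) :=
    DenseRange.piMap fun _ => Completion.denseRange_coe
  have hiso : Isometry (fun (a : Fin k → X) i => (a i : Completion X)) :=
    Isometry.piMap _ fun _ => Completion.coe_isometry
  have hui := hiso.isUniformInducing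
  have hcont := (uniformContinuous_uniformly_extend hui hdense hlip.uniformContinuous).continuous
  have hg : ∀ a : Fin k → X, (hui.isDenseInducing hdense).extend f
      (fun i => (a i : Completion X)) = f a :=
    fun a => uniformly_extend_of_ind hui hdense hlip.uniformContinuous a
  refine ⟨_, hg, fun a b => ?_⟩
  refine hdense.induction_on₂ (p := fun a b => dist ((hui.isDenseInducing hdense).extend f a)
    ((hui.isDenseInducing hdense).extend f b) ≤ C * ∑ i, dist (a i) (b i)) ?_ ?_ a b
  · exact isClosed_le ((hcont.comp continuous_fst).dist (hcont.comp continuous_snd)) (by fun_prop)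
  · intro a b
    rw [hg, hg]
    simpa using hf a b

/-- A structure whose metric may be degenerate and incomplete. -/
structure PreModel (L : LipLanguage.{u}) where
  carrier : Type u
  [metric : PseudoMetricSpace carrier]
  [nonempty : Nonempty carrier]
  dist_le_one : ∀ a b : carrier, dist a b ≤ 1
  const : L.Const → carrier
  func : ∀ F : L.Func, (Fin (L.funcArity F) → carrier) → carrier
  func_lip : ∀ (F : L.Func) (a b : Fin (L.funcArity F) → carrier),
    dist (func F a) (func F b) ≤ L.funcLip F * ∑ i, dist (a i) (b i)
  rel : ∀ R : L.Rel, (Fin (L.relArity R) → carrier) → ℝ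
  rel_mem : ∀ (R : L.Rel) (a : Fin (L.relArity R) → carrier), rel R a ∈ Set.Icc (0 : ℝ) 1
  rel_lip : ∀ (R : L.Rel) (a b : Fin (L.relArity R) → carrier),
    rel R a - rel R b ≤ L.relLip R * ∑ i, dist (a i) (b i)

attribute [instance] PreModel.metric PreModel.nonempty

namespace PreModel

variable {L : LipLanguage.{u}} (N : PreModel L)

theorem exists_func_extension (F : L.Func) :
    ∃ g : (Fin (L.funcArity F) → Completion N.carrier) → Completion N.carrier,
      (∀ a : Fin (L.funcArity F) → N.carrier, g (fun i => (a i : Completion N.carrier)) =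
        (N.func F a : Completion N.carrier)) ∧
      ∀ a b, dist (g a) (g b) ≤ L.funcLip F * ∑ i, dist (a i) (b i) :=
  exists_lipschitz_extension (fun a => (N.func F a : Completion N.carrier)) (L.funcLip F)
    fun a b => by simpa using N.func_lip F a b

theorem exists_rel_extension (R : L.Rel) :
    ∃ g : (Fin (L.relArity R) → Completion N.carrier) → Set.Icc (0 : ℝ) 1,
      (∀ a : Fin (L.relArity R) → N.carrier, g (fun i => (a i : Completion N.carrier)) =
        ⟨N.rel R a, N.rel_mem R a⟩) ∧
      ∀ a b, dist (g a) (g b) ≤ L.relLip R * ∑ i, dist (a i) (b i) := by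
  -- Extending into the complete space `[0, 1]`, rather than `ℝ`, keeps the range of the relation.
  refine exists_lipschitz_extension (Y := Set.Icc (0 : ℝ) 1)
    (fun a => ⟨N.rel R a, N.rel_mem R a⟩) (L.relLip R) fun a b => ?_
  rw [Subtype.dist_eq, Real.dist_eq]
  refine abs_sub_le_iff.2 ⟨N.rel_lip R a b, ?_⟩
  simpa [dist_comm] using N.rel_lip R b a

/-- The completion of the metric quotient of a pre-structure. -/
noncomputable def completion : Model L where
  carrier := Completion N.carrier
  nonempty := N.nonempty.map (↑)
  dist_le_one a b := by
    refine Completion.induction_on₂ a b (isClosed_le (by fun_prop) (by fun_prop)) fun a b => ?_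
    simpa using N.dist_le_one a b
  const c := (N.const c : Completion N.carrier)
  func F := (N.exists_func_extension F).choose
  func_lip F := (N.exists_func_extension F).choose_spec.2
  rel R a := (N.exists_rel_extension R).choose a
  rel_mem R a := ((N.exists_rel_extension R).choose a).2
  rel_lip R a b := (le_abs_self _).trans ((N.exists_rel_extension R).choose_spec.2 a b)

/-- The image of an element in the completion. -/
def toCompletion (a : N.carrier) : N.completion.carrier := (a : Completion N.carrier)

theorem completion_func (F : L.Func) (a : Fin (L.funcArity F) → N.carrier) :
    N.completion.func F (fun i => N.toCompletion (a i)) = N.toCompletion (N.func F a) :=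
  (N.exists_func_extension F).choose_spec.1 a

theorem completion_rel (R : L.Rel) (a : Fin (L.relArity R) → N.carrier) :
    N.completion.rel R (fun i => N.toCompletion (a i)) = N.rel R a :=
  congrArg Subtype.val ((N.exists_rel_extension R).choose_spec.1 a)

theorem completion_dist (a b : N.carrier) :
    dist (N.toCompletion a) (N.toCompletion b) = dist a b :=
  Completion.dist_eq a b

theorem denseRange_toCompletion : DenseRange N.toCompletion := Completion.denseRange_coe

/-- By continuity, an infimum over the completion is already the infimum over the dense image of the
pre-structure. -/
theorem value_completion_inf {n : ℕ} (φ : Formula L (n + 1)) (a : Fin n → N.carrier) :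
    φ.inf.value N.completion (fun i => N.toCompletion (a i)) =
      ⨅ b, φ.value N.completion
        (fun i => N.toCompletion (Fin.snoc (α := fun _ => N.carrier) a b i)) := by
  have hs : ∀ b, (fun i => N.toCompletion (Fin.snoc (α := fun _ => N.carrier) a b i)) =
      Fin.snoc (α := fun _ => N.completion.carrier) (fun i => N.toCompletion (a i))
        (N.toCompletion b) := fun b => Fin.comp_snoc N.toCompletion a b
  simp only [hs, Formula.value]
  refine le_antisymm (le_ciInf fun b => ciInf_le (φ.bddBelow_range _ _) _) (le_ciInf fun b => ?_)
  refine N.denseRange_toCompletion.induction_on (p := fun b => _ ≤ φ.value N.completion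
    (Fin.snoc (α := fun _ => N.completion.carrier) (fun i => N.toCompletion (a i)) b)) b ?_ ?_
  · exact isClosed_le continuous_const ((φ.continuous_value _).comp (continuous_snoc _))
  · exact fun b => ciInf_le (φ.bddBelow_range N.completion fun b =>
      Fin.snoc (α := fun _ => N.completion.carrier) (fun i => N.toCompletion (a i))
        (N.toCompletion b)) b

end PreModel

end Completion

/-! ### Suprema as negated infima -/

section SupAsInf

variable {L : LipLanguage.{u}} (M : Model L)

/-- Because of this, witnesses are needed for `inf` only. -/
theorem Formula.value_sup_eq_neg_inf {n : ℕ} (φ : Formula L (n + 1)) (a : Fin n → M.carrier) :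
    φ.sup.value M a = -(Formula.smul (-1) φ).inf.value M a := by
  simp only [Formula.value, neg_one_mul, iSup, iInf, Real.sInf_def, neg_neg]
  congr 1
  ext x
  simp

end SupAsInf


/-! ### Reducts -/

section Reduct

variable {S : LipLanguage.{u}} {L L' : Sublanguage S}

/-- The reduct of a structure to a smaller language. -/
def Model.reduct (h : L ⊆ L') (M : Model L'.toLang) : Model L.toLang where
  carrier := M.carrier
  dist_le_one := M.dist_le_one
  const c := M.const ⟨c.1, h.consts c.2⟩
  func F := M.func ⟨F.1, h.funcs F.2⟩
  func_lip F := M.func_lip ⟨F.1, h.funcs F.2⟩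
  rel R := M.rel ⟨R.1, h.rels R.2⟩
  rel_mem R := M.rel_mem ⟨R.1, h.rels R.2⟩
  rel_lip R := M.rel_lip ⟨R.1, h.rels R.2⟩

theorem Term.value_incl (h : L ⊆ L') (M : Model L'.toLang) {n : ℕ} (t : Term L.toLang n)
    (a : Fin n → M.carrier) : (t.incl h).value M a = t.value (M.reduct h) a := by
  induction t with
  | var i => rfl
  | const c => rfl
  | func F ts ih =>
    exact congrArg (M.func ⟨F.1, h.funcs F.2⟩) (funext ih)

theorem Formula.value_incl (h : L ⊆ L') (M : Model L'.toLang) {n : ℕ} (φ : Formula L.toLang n)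
    (a : Fin n → M.carrier) : (φ.incl h).value M a = φ.value (M.reduct h) a := by
  induction φ with
  | one => rfl
  | dist t₁ t₂ => exact congrArg₂ Dist.dist (t₁.value_incl h M a) (t₂.value_incl h M a)
  | rel R ts =>
    exact congrArg (M.rel ⟨R.1, h.rels R.2⟩) (funext fun i => (ts i).value_incl h M a)
  | add φ ψ h₁ h₂ => exact congrArg₂ (· + ·) (h₁ a) (h₂ a)
  | smul r φ ih => exact congrArg (r * ·) (ih a)
  | inf φ ih => exact iInf_congr fun b => ih _
  | sup φ ih => exact iSup_congr fun b => ih _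

end Reduct

/-! ### Functions definable from finitely many names -/

section Definability

variable {L : LipLanguage.{u}} {V : Type u}

/-- The functions of a structure and an assignment of its elements to the names in `V` that are
given by a formula and involve only the names in `T`. -/
def Definable (T : Set V) (G : ∀ M : Model L, (V → M.carrier) → ℝ) : Prop :=
  ∃ (n : ℕ) (θ : Formula L n) (h : Fin n → V), (∀ i, h i ∈ T) ∧
    ∀ (M : Model L) (v : V → M.carrier), G M v = θ.value M (fun i => v (h i))

namespace Definable

variable {T T' : Set V} {G G' : ∀ M : Model L, (V → M.carrier) → ℝ}

theorem mono (hG : Definable T G) (h : T ⊆ T') : Definable T' G := by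
  obtain ⟨n, θ, g, hg, H⟩ := hG
  exact ⟨n, θ, g, fun i => h (hg i), H⟩

theorem congr (hG : Definable T G) {M : Model L} {v w : V → M.carrier} (h : ∀ x ∈ T, v x = w x) :
    G M v = G M w := by
  obtain ⟨n, θ, g, hg, H⟩ := hG
  simp only [H, h _ (hg _)]

theorem bounded (hG : Definable T G) : ∃ C, ∀ M v, |G M v| ≤ C := by
  obtain ⟨n, θ, g, hg, H⟩ := hG
  exact ⟨θ.bound, fun M v => by rw [H]; exact θ.abs_value_le M _⟩

/-- Lets variables be indexed by any finite type, so that substitution needs no arithmetic of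
indices. -/
theorem of_fintype {ι : Type*} [Finite ι] {n : ℕ} (θ : Formula L n) (h : ι → V)
    (hT : ∀ i, h i ∈ T) (σ : ∀ m, (ι → Fin m) → Fin n → Term L m)
    (hG : ∀ m (e : ι ≃ Fin m) M (v : V → M.carrier),
      G M v = θ.value M (fun i => (σ m e i).value M fun j => v (h (e.symm j)))) :
    Definable T G := by
  obtain ⟨m, ⟨e⟩⟩ := Finite.exists_equiv_fin ι
  exact ⟨m, θ.subst (σ m e), fun j => h (e.symm j), fun j => hT _, fun M v => by
    rw [Formula.value_subst, hG m e]⟩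

theorem one : Definable T (fun (M : Model L) (_ : V → M.carrier) => (1 : ℝ)) :=
  ⟨0, .one, Fin.elim0, fun i => i.elim0, fun _ _ => rfl⟩

theorem smul (r : ℝ) (hG : Definable T G) : Definable T (fun M v => r * G M v) := by
  obtain ⟨n, θ, g, hg, H⟩ := hG
  exact ⟨n, .smul r θ, g, hg, fun M v => congrArg (r * ·) (H M v)⟩

theorem add (hG : Definable T G) (hG' : Definable T G') :
    Definable T (fun M v => G M v + G' M v) := by
  obtain ⟨n, θ, g, hg, H⟩ := hG
  obtain ⟨n', θ', g', hg', H'⟩ := hG'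
  refine ⟨n + n', .add (θ.subst fun i => .var (i.castAdd n')) (θ'.subst fun i => .var (i.natAdd n)),
    Fin.append g g', fun i => ?_, fun M v => ?_⟩
  · induction i using Fin.addCases with
    | left i => simpa using hg i
    | right i => simpa using hg' i
  · simp [Formula.value, Formula.value_subst, Term.value, H, H']

theorem dist (x y : V) (hx : x ∈ T) (hy : y ∈ T) :
    Definable T (fun (M : Model L) (v : V → M.carrier) => Dist.dist (v x) (v y)) :=
  ⟨2, .dist (.var 0) (.var 1), ![x, y], fun i => by fin_cases i <;> simpa, fun M v => by
    simp [Formula.value, Term.value]⟩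

theorem rel (R : L.Rel) (h : Fin (L.relArity R) → V) (hT : ∀ i, h i ∈ T) :
    Definable T (fun (M : Model L) (v : V → M.carrier) => M.rel R fun i => v (h i)) :=
  ⟨_, .rel R .var, h, hT, fun _ _ => rfl⟩

open Classical in
/-- Substitution of a term for a name. -/
theorem subst (hG : Definable T G) (x : V) {k : ℕ} (t : Term L k) (g : Fin k → V) :
    Definable (T \ {x} ∪ Set.range g)
      (fun M v => G M (Function.update v x (t.value M fun i => v (g i)))) := by
  obtain ⟨n, θ, h, hh, H⟩ := hG
  refine of_fintype (ι := {i // h i ≠ x} ⊕ Fin k) θ (Sum.elim (fun i => h i) g) ?_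
    (fun m e i => if hi : h i = x then t.subst (fun j => .var (e (.inr j)))
      else .var (e (.inl ⟨i, hi⟩))) fun m e M v => ?_
  · rintro (⟨i, hi⟩ | i)
    · exact .inl ⟨hh i, hi⟩
    · exact .inr ⟨i, rfl⟩
  · rw [H]
    congr 1
    funext i
    by_cases hi : h i = x
    · simp [hi, Term.value_subst, Term.value]
    · simp [hi, Term.value]

-- Prepares `x` for quantification: `h` need not be injective, so all variables named `x` are merged
-- into the last one.
open Classical in
theorem exists_abstract (hG : Definable T G) (x : V) :
    ∃ (n : ℕ) (θ : Formula L (n + 1)) (h : Fin n → V), (∀ i, h i ∈ T \ {x}) ∧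
      ∀ (M : Model L) (v : V → M.carrier) (y : M.carrier),
        G M (Function.update v x y) =
          θ.value M (Fin.snoc (α := fun _ => M.carrier) (fun i => v (h i)) y) := by
  obtain ⟨n, θ, h, hh, H⟩ := hG
  obtain ⟨m, ⟨e⟩⟩ := Finite.exists_equiv_fin {i // h i ≠ x}
  refine ⟨m, θ.subst fun i => if hi : h i = x then .var (Fin.last m)
    else .var (e ⟨i, hi⟩).castSucc, fun j => h (e.symm j), fun j => ⟨hh _, (e.symm j).2⟩,
    fun M v y => ?_⟩
  rw [H, Formula.value_subst]
  congr 1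
  funext i
  by_cases hi : h i = x
  · simp [hi, Term.value]
  · simp [hi, Term.value]

open Classical in
theorem iSup_update (hG : Definable T G) (x : V) :
    Definable (T \ {x}) (fun M v => ⨆ y, G M (Function.update v x y)) := by
  obtain ⟨n, θ, h, hh, H⟩ := hG.exists_abstract x
  exact ⟨n, .sup θ, h, hh, fun M v => by simp only [H]; rfl⟩

open Classical in
theorem iInf_update (hG : Definable T G) (x : V) :
    Definable (T \ {x}) (fun M v => ⨅ y, G M (Function.update v x y)) := by
  obtain ⟨n, θ, h, hh, H⟩ := hG.exists_abstract x
  exact ⟨n, .inf θ, h, hh, fun M v => by simp only [H]; rfl⟩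

theorem exists_sentence (hG : Definable (∅ : Set V) G) :
    ∃ θ : Sentence L, ∀ M v, G M v = Sentence.val M θ := by
  obtain ⟨n, θ, h, hh, H⟩ := hG
  obtain _ | n := n
  · refine ⟨θ, fun M v => (H M v).trans ?_⟩
    exact congrArg (θ.value M) (Subsingleton.elim _ _)
  -- A free variable would have to be named by an element of the empty set.
  · exact (hh 0).elim

end Definable

end Definability

/-! ### Names and their elimination -/

section Names

variable {S : LipLanguage.{u}} (Ls : Bool → Sublanguage S)

/-- Names for the elements of a structure in the union of the languages `Ls b`: the names are closed
under the symbols, and contain approximate witnesses for the formulas of each `Ls b`. -/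
inductive Name : Type u
  | const (c : S.Const) : Name
  | func (F : S.Func) (h : Fin (S.funcArity F) → Name) : Name
  | wit (b : Bool) {k : ℕ} (φ : Formula (Ls b).toLang (k + 1)) (h : Fin k → Name) (n : ℕ) : Name

theorem Formula.exists_near_inf {L : LipLanguage.{u}} (M : Model L) {k : ℕ}
    (φ : Formula L (k + 1)) (a : Fin k → M.carrier) (n : ℕ) :
    ∃ y : M.carrier, φ.value M (Fin.snoc a y) ≤ φ.inf.value M a + 1 / (n + 1) := by
  obtain ⟨y, hy⟩ := exists_lt_of_ciInf_lt (lt_add_of_pos_right (φ.inf.value M a)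
    (Nat.one_div_pos_of_nat (n := n)))
  exact ⟨y, hy.le⟩

variable {Ls}

namespace Name

instance : Nonempty (Name Ls) := ⟨.wit true (k := 0) .one Fin.elim0 0⟩

/-- The number of constructors of a name. -/
def size : Name Ls → ℕ
  | .const _ => 0
  | .func _ h => (∑ i, (h i).size) + 1
  | .wit _ _ h _ => (∑ i, (h i).size) + 1

theorem size_lt_func (F : S.Func) (h : Fin (S.funcArity F) → Name Ls) (i) :
    (h i).size < (Name.func F h).size :=
  Nat.lt_succ_of_le
    (Finset.single_le_sum (f := fun i => (h i).size) (fun _ _ => Nat.zero_le _) (Finset.mem_univ i))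

theorem size_lt_wit (b : Bool) {k : ℕ} (φ : Formula (Ls b).toLang (k + 1)) (h : Fin k → Name Ls)
    (n : ℕ) (i) : (h i).size < (Name.wit b φ h n).size :=
  Nat.lt_succ_of_le
    (Finset.single_le_sum (f := fun i => (h i).size) (fun _ _ => Nat.zero_le _) (Finset.mem_univ i))

open Classical in
/-- The interpretation of the names in an `Ls b`-structure. Names that do not refer to `Ls b` are
given arbitrary values. -/
noncomputable def eval (b : Bool) (M : Model (Ls b).toLang) (s : Name Ls → M.carrier) :
    Name Ls → M.carrier
  | .const c => if hc : c ∈ (Ls b).consts then M.const ⟨c, hc⟩ else s (.const c)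
  | .func F h =>
    if hF : F ∈ (Ls b).funcs then M.func ⟨F, hF⟩ (fun i => (h i).eval b M s) else s (.func F h)
  | .wit b' φ h n =>
    if e : b' = b then
      ((e ▸ φ : Formula (Ls b).toLang _).exists_near_inf M (fun i => (h i).eval b M s) n).choose
    else s (.wit b' φ h n)

variable {b : Bool} (M : Model (Ls b).toLang) (s : Name Ls → M.carrier)

theorem eval_const {c : S.Const} (hc : c ∈ (Ls b).consts) :
    (Name.const c).eval b M s = M.const ⟨c, hc⟩ := by
  simp [eval, hc]

theorem eval_func {F : S.Func} (hF : F ∈ (Ls b).funcs) (h : Fin (S.funcArity F) → Name Ls) :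
    (Name.func F h).eval b M s = M.func ⟨F, hF⟩ (fun i => (h i).eval b M s) := by
  simp [eval, hF]

theorem value_eval_wit {k : ℕ} (φ : Formula (Ls b).toLang (k + 1)) (h : Fin k → Name Ls) (n : ℕ) :
    φ.value M (Fin.snoc (fun i => (h i).eval b M s) ((Name.wit b φ h n).eval b M s)) ≤
      φ.inf.value M (fun i => (h i).eval b M s) + 1 / (n + 1) := by
  have : (Name.wit b φ h n).eval b M s =
      (φ.exists_near_inf M (fun i => (h i).eval b M s) n).choose := by simp [eval]
  rw [this]
  exact (φ.exists_near_inf M (fun i => (h i).eval b M s) n).choose_spec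

/-- The names that do not refer to `Ls b`. -/
def IsFree (b : Bool) : Name Ls → Prop
  | .const c => c ∉ (Ls b).consts
  | .func F _ => F ∉ (Ls b).funcs
  | .wit b' _ _ _ => b' ≠ b

theorem IsFree.eval_eq {x : Name Ls} (hx : x.IsFree b) : x.eval b M s = s x := by
  cases x with
  | const c => simp [eval, show c ∉ (Ls b).consts from hx]
  | func F h => simp [eval, show F ∉ (Ls b).funcs from hx]
  | wit b' φ h n => simp [eval, show b' ≠ b from hx]

-- Evaluating `z` consults `s` only at `z` and its subnames. Proper subnames are smaller than `z`,
-- so `x` is not among them.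
open Classical in
theorem eval_update_of_size_le {x : Name Ls} (y : M.carrier) {z : Name Ls} (hzx : z ≠ x)
    (hsize : z.size ≤ x.size) : z.eval b M (Function.update s x y) = z.eval b M s := by
  induction z with
  | const c => simp [eval, Function.update_of_ne hzx]
  | func F h ih =>
    have hlt := fun i => (size_lt_func F h i).trans_le hsize
    have : ∀ i, (h i).eval b M (Function.update s x y) = (h i).eval b M s := fun i =>
      ih i (by rintro rfl; exact (hlt i).false) (hlt i).le
    by_cases hF : F ∈ (Ls b).funcs
    · rw [eval_func _ _ hF, eval_func _ _ hF]
      exact congrArg (M.func ⟨F, hF⟩) (funext this)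
    · simp [eval, hF, Function.update_of_ne hzx]
  | wit b' φ h n ih =>
    have hlt := fun i => (size_lt_wit b' φ h n i).trans_le hsize
    have : ∀ i, (h i).eval b M (Function.update s x y) = (h i).eval b M s := fun i =>
      ih i (by rintro rfl; exact (hlt i).false) (hlt i).le
    simp [eval, Function.update_of_ne hzx, this]

/-- A set of names that contains the arguments of its function names. -/
def ArgClosed (T : Finset (Name Ls)) : Prop :=
  ∀ (F : S.Func) (h : Fin (S.funcArity F) → Name Ls), Name.func F h ∈ T → ∀ i, h i ∈ T

open Classical in
theorem ArgClosed.biUnion {k : ℕ} {T : Fin k → Finset (Name Ls)} (hT : ∀ i, ArgClosed (T i)) :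
    ArgClosed (Finset.univ.biUnion T) := by
  intro F h hF i
  obtain ⟨j, -, hj⟩ := Finset.mem_biUnion.1 hF
  exact Finset.mem_biUnion.2 ⟨j, Finset.mem_univ j, hT j F h hj i⟩

open Classical in
theorem exists_argClosed (x : Name Ls) : ∃ T : Finset (Name Ls), x ∈ T ∧ ArgClosed T := by
  induction x with
  | const c => exact ⟨{.const c}, by simp, fun F h hF => by simp at hF⟩
  | func F h ih =>
    choose T hT hc using ih
    refine ⟨insert (.func F h) (Finset.univ.biUnion T), Finset.mem_insert_self _ _, ?_⟩
    intro F' h' hF' i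
    refine Finset.mem_insert_of_mem ?_
    rcases Finset.mem_insert.1 hF' with h | h
    · cases h
      exact Finset.mem_biUnion.2 ⟨i, Finset.mem_univ i, hT i⟩
    · exact ArgClosed.biUnion hc _ _ h i
  -- Arguments of witnesses need not be included: a witness belongs to one side only, so it gets
  -- quantified and never unfolded.
  | wit b φ h n ih => exact ⟨{.wit b φ h n}, by simp, fun F h hF => by simp at hF⟩

open Classical in
theorem exists_argClosed_of_fin {k : ℕ} (h : Fin k → Name Ls) :
    ∃ T : Finset (Name Ls), (∀ i, h i ∈ T) ∧ ArgClosed T := by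
  choose T hT hc using fun i => exists_argClosed (h i)
  exact ⟨Finset.univ.biUnion T, fun i => Finset.mem_biUnion.2 ⟨i, Finset.mem_univ i, hT i⟩,
    ArgClosed.biUnion hc⟩

end Name

theorem inter_subset_side (b : Bool) : Ls true ∩ Ls false ⊆ Ls b := by
  cases b
  · exact Sublanguage.inter_subset_right _ _
  · exact Sublanguage.inter_subset_left _ _

theorem side_subset_union (b : Bool) : Ls b ⊆ Ls true ∪ Ls false := by
  cases b
  · exact Sublanguage.subset_union_right _ _
  · exact Sublanguage.subset_union_left _ _

/-- The value of a function of assignments at the interpretation of the names. -/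
noncomputable def atNames (G : ∀ M : Model (Ls true ∩ Ls false).toLang, (Name Ls → M.carrier) → ℝ)
    (b : Bool) (M : Model (Ls b).toLang) (s : Name Ls → M.carrier) : ℝ :=
  G (M.reduct (inter_subset_side b)) (fun x => x.eval b M s)

-- Every name is foreign to the first language, foreign to the second, or headed by a common symbol.
-- A foreign name takes arbitrary values on its foreign side, so an inequality there survives the
-- quantifier; on the other side its actual value is one instance of the quantifier.
open Classical in
theorem exists_definable_erase {x : Name Ls} {T : Finset (Name Ls)} (hxT : x ∈ T)
    (hT : Name.ArgClosed T) (hmax : ∀ z ∈ T, z.size ≤ x.size)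
    {G : ∀ M : Model (Ls true ∩ Ls false).toLang, (Name Ls → M.carrier) → ℝ}
    (hG : Definable (T : Set (Name Ls)) G)
    {A : Model (Ls true).toLang → ℝ} {B : Model (Ls false).toLang → ℝ}
    (hA : ∀ M s, A M ≤ atNames G true M s) (hB : ∀ M s, atNames G false M s ≤ B M) :
    ∃ G' : ∀ M : Model (Ls true ∩ Ls false).toLang, (Name Ls → M.carrier) → ℝ,
      Definable ((T.erase x : Finset (Name Ls)) : Set (Name Ls)) G' ∧
      (∀ M s, A M ≤ atNames G' true M s) ∧ (∀ M s, atNames G' false M s ≤ B M) := by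
  have hset : ((T.erase x : Finset (Name Ls)) : Set (Name Ls)) = (T : Set (Name Ls)) \ {x} := by simp
  rw [hset]
  obtain ⟨C, hC⟩ := hG.bounded
  have habove : ∀ (M : Model (Ls true ∩ Ls false).toLang) (v : Name Ls → M.carrier),
      BddAbove (Set.range fun y => G M (Function.update v x y)) :=
    fun M v => ⟨C, by rintro _ ⟨y, rfl⟩; exact (abs_le.1 (hC M _)).2⟩
  have hbelow : ∀ (M : Model (Ls true ∩ Ls false).toLang) (v : Name Ls → M.carrier),
      BddBelow (Set.range fun y => G M (Function.update v x y)) :=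
    fun M v => ⟨-C, by rintro _ ⟨y, rfl⟩; exact (abs_le.1 (hC M _)).1⟩
  -- For foreign `x`, changing its value directly amounts to changing the assignment. Maximality of
  -- `x` ensures that no other name in `T` is affected.
  have hupdate : ∀ (b : Bool) (M : Model (Ls b).toLang) (s : Name Ls → M.carrier) (y : M.carrier),
      x.IsFree b → G (M.reduct (inter_subset_side b))
        (Function.update (fun z => z.eval b M s) x y) =
        atNames G b M (Function.update s x y) := by
    intro b M s y hx
    refine hG.congr fun z hz => ?_
    by_cases hzx : z = x
    · subst hzx
      exact (Function.update_self (β := fun _ => M.carrier) z y _).trans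
        ((hx.eval_eq M _).trans (Function.update_self z y s)).symm
    · exact (Function.update_of_ne hzx y _).trans
        (Name.eval_update_of_size_le M s y hzx (hmax z hz)).symm
  have hself : ∀ (b : Bool) (M : Model (Ls b).toLang) (s : Name Ls → M.carrier),
      atNames G b M s = G (M.reduct (inter_subset_side b))
        (Function.update (fun z => z.eval b M s) x (x.eval b M s)) := by
    intro b M s
    exact congrArg (G (M.reduct (inter_subset_side b)))
      (Function.update_eq_self x (fun z => z.eval b M s)).symm
  have hsup : x.IsFree false → ∃ G' : ∀ M : Model (Ls true ∩ Ls false).toLang,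
      (Name Ls → M.carrier) → ℝ, Definable ((T : Set (Name Ls)) \ {x}) G' ∧
      (∀ M s, A M ≤ atNames G' true M s) ∧ (∀ M s, atNames G' false M s ≤ B M) := by
    intro hx
    refine ⟨_, hG.iSup_update x, fun M s => ?_, fun M s => ?_⟩
    · refine (hA M s).trans ((hself true M s).trans_le ?_)
      exact le_ciSup (habove (M.reduct (inter_subset_side true)) fun z => z.eval true M s)
        (x.eval true M s)
    · have : Nonempty (M.reduct (inter_subset_side false)).carrier := M.nonempty
      exact ciSup_le fun y => (hupdate false M s y hx).trans_le (hB M _)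
  have hinf : x.IsFree true → ∃ G' : ∀ M : Model (Ls true ∩ Ls false).toLang,
      (Name Ls → M.carrier) → ℝ, Definable ((T : Set (Name Ls)) \ {x}) G' ∧
      (∀ M s, A M ≤ atNames G' true M s) ∧ (∀ M s, atNames G' false M s ≤ B M) := by
    intro hx
    refine ⟨_, hG.iInf_update x, fun M s => ?_, fun M s => ?_⟩
    · have : Nonempty (M.reduct (inter_subset_side true)).carrier := M.nonempty
      exact le_ciInf fun y => (hA M _).trans_eq (hupdate true M s y hx).symm
    · refine le_trans ?_ (hB M s)
      rw [hself false M s]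
      exact ciInf_le (hbelow (M.reduct (inter_subset_side false)) fun z => z.eval false M s)
        (x.eval false M s)
  -- A name that both sides evaluate by the same common term can be replaced by that term.
  have hsubst : ∀ {k : ℕ} (t : Term (Ls true ∩ Ls false).toLang k) (g : Fin k → Name Ls),
      (∀ i, g i ∈ (T : Set (Name Ls)) \ {x}) →
      (∀ (b : Bool) (M : Model (Ls b).toLang) (s : Name Ls → M.carrier),
        t.value (M.reduct (inter_subset_side b)) (fun i => (g i).eval b M s) = x.eval b M s) →
      ∃ G' : ∀ M : Model (Ls true ∩ Ls false).toLang,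
      (Name Ls → M.carrier) → ℝ, Definable ((T : Set (Name Ls)) \ {x}) G' ∧
      (∀ M s, A M ≤ atNames G' true M s) ∧ (∀ M s, atNames G' false M s ≤ B M) := by
    intro k t g hg ht
    have heq : ∀ (b : Bool) (M : Model (Ls b).toLang) (s : Name Ls → M.carrier),
        atNames (fun M v => G M (Function.update v x (t.value M fun i => v (g i)))) b M s =
          atNames G b M s := by
      intro b M s
      rw [hself b M s, ← ht b M s]
      rfl
    refine ⟨_, (hG.subst x t g).mono ?_, fun M s => (hA M s).trans_eq (heq true M s).symm,
      fun M s => (heq false M s).trans_le (hB M s)⟩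
    rintro z (hz | ⟨i, rfl⟩)
    · exact hz
    · exact hg i
  cases x with
  | const c =>
    by_cases h₁ : c ∈ (Ls true).consts
    · by_cases h₂ : c ∈ (Ls false).consts
      · refine hsubst (.const (L := (Ls true ∩ Ls false).toLang) ⟨c, h₁, h₂⟩) (k := 0) Fin.elim0
          (fun i => i.elim0) fun b M s => ?_
        exact (Name.eval_const M s ((inter_subset_side b).consts ⟨h₁, h₂⟩)).symm
      · exact hsup h₂
    · exact hinf h₁
  | func F h =>
    by_cases h₁ : F ∈ (Ls true).funcs
    · by_cases h₂ : F ∈ (Ls false).funcs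
      · refine hsubst (.func (L := (Ls true ∩ Ls false).toLang) ⟨F, h₁, h₂⟩ .var) h
          (fun i => ⟨hT F h hxT i, ?_⟩) fun b M s => ?_
        · intro hi
          exact (Name.size_lt_func F h i).ne (congrArg Name.size hi)
        · exact (Name.eval_func M s ((inter_subset_side b).funcs ⟨h₁, h₂⟩) h).symm
      · exact hsup h₂
    · exact hinf h₁
  | wit b φ h n =>
    cases b
    · exact hinf (show false ≠ true by decide)
    · exact hsup (show true ≠ false by decide)

open Classical in
theorem exists_sentence_of_argClosed (T : Finset (Name Ls)) (hT : Name.ArgClosed T)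
    {G : ∀ M : Model (Ls true ∩ Ls false).toLang, (Name Ls → M.carrier) → ℝ}
    (hG : Definable (T : Set (Name Ls)) G)
    {A : Model (Ls true).toLang → ℝ} {B : Model (Ls false).toLang → ℝ}
    (hA : ∀ M s, A M ≤ atNames G true M s) (hB : ∀ M s, atNames G false M s ≤ B M) :
    ∃ θ : Sentence (Ls true ∩ Ls false).toLang,
      (∀ M, A M ≤ Sentence.val (M.reduct (inter_subset_side true)) θ) ∧
      ∀ M, Sentence.val (M.reduct (inter_subset_side false)) θ ≤ B M := by
  induction hn : T.card generalizing T G with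
  | zero =>
    obtain rfl := Finset.card_eq_zero.1 hn
    rw [Finset.coe_empty] at hG
    obtain ⟨θ, hθ⟩ := hG.exists_sentence
    refine ⟨θ, fun M => ?_, fun M => ?_⟩
    · exact (hA M fun _ => Classical.arbitrary _).trans_eq (hθ _ _)
    · exact (hθ _ _).symm.trans_le (hB M fun _ => Classical.arbitrary _)
  | succ n ih =>
    -- A name of maximal size is not an argument of another name in `T`, so erasing it preserves
    -- closure under arguments.
    obtain ⟨x, hxT, hmax⟩ := T.exists_max_image Name.size (Finset.card_pos.1 (by omega))
    obtain ⟨G', hG', hA', hB'⟩ := exists_definable_erase hxT hT hmax hG hA hB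
    refine ih (T.erase x) ?_ hG' hA' hB' (by rw [Finset.card_erase_of_mem hxT]; omega)
    intro F h hF i
    refine Finset.mem_erase.2 ⟨?_, hT F h (Finset.mem_of_mem_erase hF) i⟩
    rintro rfl
    exact ((Name.size_lt_func F h i).trans_le (hmax _ (Finset.mem_of_mem_erase hF))).false

/-- Names can be eliminated from an interpolating formula. -/
theorem exists_sentence_of_definable
    {G : ∀ M : Model (Ls true ∩ Ls false).toLang, (Name Ls → M.carrier) → ℝ}
    (hG : Definable Set.univ G)
    {A : Model (Ls true).toLang → ℝ} {B : Model (Ls false).toLang → ℝ}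
    (hA : ∀ M s, A M ≤ atNames G true M s) (hB : ∀ M s, atNames G false M s ≤ B M) :
    ∃ θ : Sentence (Ls true ∩ Ls false).toLang,
      (∀ M, A M ≤ Sentence.val (M.reduct (inter_subset_side true)) θ) ∧
      ∀ M, Sentence.val (M.reduct (inter_subset_side false)) θ ≤ B M := by
  obtain ⟨n, θ, h, -, H⟩ := hG
  obtain ⟨T, hT, hc⟩ := Name.exists_argClosed_of_fin h
  exact exists_sentence_of_argClosed T hc ⟨n, θ, h, hT, H⟩ hA hB

end Names


/-! ### Finitely additive means and separation -/

section States

/-- The bounded real-valued functions. -/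
def boundedFun (Z : Type*) : Submodule ℝ (Z → ℝ) where
  carrier := {f | ∃ C, ∀ z, |f z| ≤ C}
  zero_mem' := ⟨0, fun z => by simp⟩
  add_mem' := by
    rintro f g ⟨C, hC⟩ ⟨D, hD⟩
    exact ⟨C + D, fun z => (abs_add_le _ _).trans (add_le_add (hC z) (hD z))⟩
  smul_mem' := by
    rintro r f ⟨C, hC⟩
    exact ⟨|r| * C, fun z => by
      simpa [abs_mul] using mul_le_mul_of_nonneg_left (hC z) (abs_nonneg r)⟩

theorem one_mem_boundedFun (Z : Type*) : (1 : Z → ℝ) ∈ boundedFun Z := ⟨1, fun z => by simp⟩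

/-- A linear functional that restricts to a finitely additive mean on the bounded functions. -/
structure IsMean {Z : Type*} (P : (Z → ℝ) →ₗ[ℝ] ℝ) : Prop where
  map_one : P 1 = 1
  nonneg : ∀ f ∈ boundedFun Z, 0 ≤ f → 0 ≤ P f

theorem IsMean.mono {Z : Type*} {P : (Z → ℝ) →ₗ[ℝ] ℝ} (hP : IsMean P) {f g : Z → ℝ}
    (hf : f ∈ boundedFun Z) (hg : g ∈ boundedFun Z) (hfg : f ≤ g) : P f ≤ P g := by
  have := hP.nonneg (g - f) (Submodule.sub_mem _ hg hf) (sub_nonneg.2 hfg)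
  rwa [map_sub, sub_nonneg] at this

theorem IsMean.map_const {Z : Type*} {P : (Z → ℝ) →ₗ[ℝ] ℝ} (hP : IsMean P) (r : ℝ) :
    P (fun _ => r) = r := by
  have : (fun _ : Z => r) = r • (1 : Z → ℝ) := by ext; simp
  rw [this, map_smul, hP.map_one, smul_eq_mul, mul_one]

/-- A cone of bounded functions none of which is uniformly negative is nonnegative for
some mean. -/
theorem exists_isMean_nonneg {Z : Type*} (K : PointedCone ℝ (Z → ℝ))
    (hK : ∀ f ∈ K, f ∈ boundedFun Z) (hneg : ∀ f ∈ K, ∀ r < 0, ∃ z, r < f z) :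
    ∃ P : (Z → ℝ) →ₗ[ℝ] ℝ, IsMean P ∧ ∀ f ∈ K, 0 ≤ P f := by
  obtain ⟨z₀, -⟩ := hneg 0 K.zero_mem (-1) (by norm_num)
  let e : boundedFun Z := ⟨1, one_mem_boundedFun Z⟩
  have he : e ≠ 0 := fun h => one_ne_zero (congrFun (congrArg Subtype.val h) z₀)
  -- The upward closure of `K` contains both `K` and the nonnegative functions, so one positivity
  -- condition covers both.
  let s : PointedCone ℝ (boundedFun Z) :=
    { carrier := {f | ∃ k ∈ K, k ≤ (f : Z → ℝ)}
      zero_mem' := ⟨0, K.zero_mem, le_rfl⟩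
      add_mem' := by
        rintro f g ⟨k, hk, hkf⟩ ⟨l, hl, hlg⟩
        exact ⟨k + l, K.add_mem hk hl, add_le_add hkf hlg⟩
      smul_mem' := by
        rintro c f ⟨k, hk, hkf⟩
        exact ⟨c • k, K.smul_mem c.2 hk, fun z => mul_le_mul_of_nonneg_left (hkf z) c.2⟩ }
  obtain ⟨g, hg, hgs⟩ := riesz_extension s (LinearPMap.mkSpanSingleton e (1 : ℝ) he) (by
    rintro ⟨x, hx⟩ ⟨k, hk, hkx⟩
    obtain ⟨r, rfl⟩ := Submodule.mem_span_singleton.1 hx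
    have hval := LinearPMap.mkSpanSingleton'_apply e (1 : ℝ)
      (fun c hc => by simp [(smul_eq_zero.1 hc).resolve_right he]) r hx
    refine le_of_le_of_eq ?_ (hval.trans (mul_one r)).symm
    by_contra! hr
    obtain ⟨z, hz⟩ := hneg k hk r hr
    exact (hz.trans_le (hkx z)).ne (by simp [e])) (by
    rintro ⟨f, C, hC⟩
    -- Adding a bound of `f` makes it nonnegative, hence above `0 ∈ K`.
    refine ⟨⟨C • e, Submodule.mem_span_singleton.2 ⟨C, rfl⟩⟩, 0, K.zero_mem, fun z => ?_⟩
    have := (abs_le.1 (hC z)).1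
    simp only [Submodule.coe_add, Submodule.coe_smul, Pi.add_apply, Pi.smul_apply, Pi.zero_apply,
      smul_eq_mul, e, Pi.one_apply]
    linarith)
  -- The linear extension to unbounded functions is arbitrary and only avoids working with a
  -- subtype.
  obtain ⟨P, hP⟩ := LinearMap.exists_extend g
  have hPg : ∀ f (hf : f ∈ boundedFun Z), P f = g ⟨f, hf⟩ := fun f hf =>
    LinearMap.congr_fun hP ⟨f, hf⟩
  refine ⟨P, ⟨?_, fun f hf h => ?_⟩, fun f hf => ?_⟩
  · rw [hPg _ (one_mem_boundedFun Z)]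
    refine (hg ⟨e, Submodule.mem_span_singleton_self e⟩).trans ?_
    exact LinearPMap.mkSpanSingleton_apply ℝ ℝ he (1 : ℝ)
  · rw [hPg _ hf]
    exact hgs _ ⟨0, K.zero_mem, h⟩
  · rw [hPg _ (hK f hf)]
    exact hgs _ ⟨f, hf, le_rfl⟩

/-- The extension by zero of a function to a disjoint union. -/
noncomputable def extendZero (X : Bool → Type*) (b : Bool) : (X b → ℝ) →ₗ[ℝ] ((Σ b, X b) → ℝ) where
  toFun f z := if h : z.1 = b then f (h ▸ z.2) else 0
  map_add' f g := by ext z; by_cases h : z.1 = b <;> simp [h]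
  map_smul' r f := by ext z; by_cases h : z.1 = b <;> simp [h]

theorem extendZero_mem {X : Bool → Type*} {b : Bool} {f : X b → ℝ} (hf : f ∈ boundedFun (X b)) :
    extendZero X b f ∈ boundedFun (Σ b, X b) := by
  obtain ⟨C, hC⟩ := hf
  refine ⟨|C|, fun ⟨c, x⟩ => ?_⟩
  by_cases h : c = b
  · subst h
    simpa [extendZero] using (hC x).trans (le_abs_self C)
  · simp [extendZero, h]

theorem extendZero_nonneg {X : Bool → Type*} {b : Bool} {f : X b → ℝ} (hf : 0 ≤ f) :
    0 ≤ extendZero X b f := by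
  rintro ⟨c, x⟩
  by_cases h : c = b
  · subst h
    simpa [extendZero] using hf x
  · simp [extendZero, h]

/-- The function on a disjoint union of two sets given by two functions. -/
noncomputable def glue {X : Bool → Type*} (f : X true → ℝ) (g : X false → ℝ) : (Σ b, X b) → ℝ :=
  extendZero X true f + extendZero X false g

theorem glue_true {X : Bool → Type*} (f : X true → ℝ) (g : X false → ℝ) (x : X true) :
    glue f g ⟨true, x⟩ = f x := by simp [glue, extendZero]

theorem glue_false {X : Bool → Type*} (f : X true → ℝ) (g : X false → ℝ) (x : X false) :
    glue f g ⟨false, x⟩ = g x := by simp [glue, extendZero]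

/-- If no element of a subspace `D` of pairs of bounded functions separates `f` from `g`, then there
are two means that agree on `D` such that the mean of `g` is at most the mean of `f`. -/
theorem exists_isMean_pair {X : Bool → Type*}
    (D : Submodule ℝ (∀ b, X b → ℝ)) (hD : ∀ d ∈ D, ∀ b, d b ∈ boundedFun (X b)) (hone : 1 ∈ D)
    {f : X true → ℝ} {g : X false → ℝ} (hf : f ∈ boundedFun (X true)) (hg : g ∈ boundedFun (X false))
    (hsep : ∀ d ∈ D, ¬ (f ≤ d true ∧ d false ≤ g)) :
    ∃ P : ∀ b, (X b → ℝ) →ₗ[ℝ] ℝ, (∀ b, IsMean (P b)) ∧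
      (∀ d ∈ D, P true (d true) = P false (d false)) ∧ P false g ≤ P true f := by
  -- Nonnegativity on this cone encodes both conclusions: `c = 0` with `±d` gives agreement on `D`,
  -- while `d = 0`, `c = 1` compares `f` with `g`.
  let K : PointedCone ℝ ((Σ b, X b) → ℝ) :=
    { carrier := {k | ∃ d ∈ D, ∃ c : ℝ, 0 ≤ c ∧ k = glue (c • f - d true) (d false - c • g)}
      zero_mem' := ⟨0, D.zero_mem, 0, le_rfl, by simp [glue]⟩
      add_mem' := by
        rintro _ _ ⟨d, hd, c, hc, rfl⟩ ⟨d', hd', c', hc', rfl⟩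
        refine ⟨d + d', D.add_mem hd hd', c + c', add_nonneg hc hc', ?_⟩
        simp only [glue, map_sub, map_smul, Pi.add_apply, map_add, add_smul]
        abel
      smul_mem' := by
        rintro r _ ⟨d, hd, c, hc, rfl⟩
        refine ⟨(r : ℝ) • d, D.smul_mem _ hd, r * c, mul_nonneg r.2 hc, ?_⟩
        change (r : ℝ) • glue _ _ = _
        simp only [glue, map_sub, map_smul, Pi.smul_apply, smul_add, smul_sub, mul_smul] }
  obtain ⟨P, hP, hPK⟩ := exists_isMean_nonneg K (by
    rintro _ ⟨d, hd, c, hc, rfl⟩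
    exact Submodule.add_mem _
      (extendZero_mem (Submodule.sub_mem _ (Submodule.smul_mem _ _ hf) (hD d hd true)))
      (extendZero_mem (Submodule.sub_mem _ (hD d hd false) (Submodule.smul_mem _ _ hg)))) (by
    rintro _ ⟨d, hd, c, hc, rfl⟩ r hr
    by_contra! hle
    have h₁ : ∀ x, c * f x - d true x ≤ r := fun x => by
      simpa [glue_true] using hle ⟨true, x⟩
    have h₂ : ∀ x, d false x - c * g x ≤ r := fun x => by
      simpa [glue_false] using hle ⟨false, x⟩
    -- A uniformly negative element would give a separating `d`. For `c = 0`, `d` is at least `-r >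
    -- 0` on one side and at most `r < 0` on the other, so a large multiple separates the bounded
    -- functions `f` and `g`; for `c > 0`, divide by `c`.
    rcases hc.eq_or_lt with rfl | hc
    · obtain ⟨A, hA⟩ := hf
      obtain ⟨B, hB⟩ := hg
      have hr' : 0 < -r := neg_pos.2 hr
      refine hsep ((max |A| |B| / (-r)) • d) (D.smul_mem _ hd) ⟨fun x => ?_, fun x => ?_⟩
      · have h₃ : -r ≤ d true x := by have := h₁ x; linarith
        have h₄ := mul_le_mul_of_nonneg_left h₃ (show 0 ≤ max |A| |B| / (-r) by positivity)
        rw [div_mul_cancel₀ _ hr'.ne'] at h₄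
        exact ((le_abs_self _).trans ((hA x).trans ((le_abs_self _).trans (le_max_left _ _)))).trans h₄
      · have h₃ : d false x ≤ -(-r) := by have := h₂ x; linarith
        have h₄ := mul_le_mul_of_nonneg_left h₃ (show 0 ≤ max |A| |B| / (-r) by positivity)
        rw [mul_neg, div_mul_cancel₀ _ hr'.ne'] at h₄
        exact h₄.trans (neg_le.1 ((neg_le_abs _).trans
          ((hB x).trans ((le_abs_self _).trans (le_max_right _ _)))))
    · refine hsep (c⁻¹ • d) (D.smul_mem _ hd) ⟨fun x => ?_, fun x => ?_⟩
      · have := h₁ x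
        simp only [Pi.smul_apply, smul_eq_mul]
        rw [le_inv_mul_iff₀ hc]
        linarith
      · have := h₂ x
        simp only [Pi.smul_apply, smul_eq_mul]
        rw [inv_mul_le_iff₀ hc]
        linarith)
  have hK : ∀ d ∈ D, ∀ c : ℝ, 0 ≤ c →
      0 ≤ P (extendZero X true (c • f - d true)) + P (extendZero X false (d false - c • g)) :=
    fun d hd c hc => (hPK _ ⟨d, hd, c, hc, rfl⟩).trans_eq (map_add P _ _)
  have hagree : ∀ d ∈ D, P (extendZero X true (d true)) = P (extendZero X false (d false)) := by
    intro d hd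
    have h₁ := hK d hd 0 le_rfl
    have h₂ := hK (-d) (D.neg_mem hd) 0 le_rfl
    simp only [zero_smul, zero_sub, sub_zero, map_neg, Pi.neg_apply, neg_neg] at h₁ h₂
    linarith
  have hsum : P (extendZero X true 1) + P (extendZero X false 1) = 1 := by
    rw [← map_add, ← hP.map_one]
    congr 1
    ext ⟨b, x⟩
    cases b <;> simp [extendZero]
  -- Since `1 ∈ D`, each side carries mass one half, whence the factor `2` below.
  have hhalf := hagree 1 hone
  simp only [Pi.one_apply] at hhalf
  refine ⟨fun b => (2 : ℝ) • P.comp (extendZero X b), fun b => ⟨?_, fun f hf h => ?_⟩,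
    fun d hd => ?_, ?_⟩
  · cases b <;> simp only [LinearMap.smul_apply, LinearMap.comp_apply, smul_eq_mul] <;> linarith
  · exact mul_nonneg two_pos.le (hP.nonneg _ (extendZero_mem hf) (extendZero_nonneg h))
  · simp only [LinearMap.smul_apply, LinearMap.comp_apply, hagree d hd]
  · have := hK 0 D.zero_mem 1 zero_le_one
    simp only [one_smul, Pi.zero_apply, sub_zero, zero_sub, map_neg] at this
    simp only [LinearMap.smul_apply, LinearMap.comp_apply, smul_eq_mul]
    linarith

end States


/-! ### The structure on names given by compatible means -/

section NameModel

variable {S : LipLanguage.{u}} {Ls : Bool → Sublanguage S}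

/-- An `Ls b`-structure together with arbitrary values for the names. -/
abbrev Point (Ls : Bool → Sublanguage S) (b : Bool) : Type (u + 1) :=
  Σ M : Model (Ls b).toLang, (Name Ls → M.carrier)

/-- The interpretation of a name at a point. -/
noncomputable def Point.eval {b : Bool} (p : Point Ls b) (x : Name Ls) : p.1.carrier :=
  x.eval b p.1 p.2

theorem Formula.value_mem_boundedFun {b : Bool} {n : ℕ} (φ : Formula (Ls b).toLang n)
    (h : Fin n → Name Ls) :
    (fun p : Point Ls b => φ.value p.1 (fun i => p.eval (h i))) ∈ boundedFun (Point Ls b) :=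
  ⟨φ.bound, fun p => φ.abs_value_le p.1 _⟩

theorem dist_mem_boundedFun {b : Bool} (x y : Name Ls) :
    (fun p : Point Ls b => dist (p.eval x) (p.eval y)) ∈ boundedFun (Point Ls b) :=
  ⟨1, fun p => by simpa [abs_of_nonneg dist_nonneg] using p.1.dist_le_one _ _⟩

/-- The pairs of functions on the points given by a formula in the common language. -/
def commonFormulas (Ls : Bool → Sublanguage S) : Submodule ℝ (∀ b, Point Ls b → ℝ) where
  carrier := {d | ∃ G : ∀ M : Model (Ls true ∩ Ls false).toLang, (Name Ls → M.carrier) → ℝ,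
    Definable Set.univ G ∧ d = fun b p => atNames G b p.1 p.2}
  zero_mem' := ⟨_, Definable.one.smul 0, by ext; simp [atNames]⟩
  add_mem' := by
    rintro _ _ ⟨G, hG, rfl⟩ ⟨G', hG', rfl⟩
    exact ⟨_, hG.add hG', rfl⟩
  smul_mem' := by
    rintro r _ ⟨G, hG, rfl⟩
    exact ⟨_, hG.smul r, rfl⟩

/-- A pair of means that agree on the formulas of the common language. -/
structure CompatibleMeans (Ls : Bool → Sublanguage S) where
  mean : ∀ b, (Point Ls b → ℝ) →ₗ[ℝ] ℝ
  isMean : ∀ b, IsMean (mean b)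
  agree : ∀ d ∈ commonFormulas Ls, mean true (d true) = mean false (d false)

namespace CompatibleMeans

variable (P : CompatibleMeans Ls)

/-- The mean distance of two names. -/
noncomputable def nameDist (x y : Name Ls) : ℝ :=
  P.mean true fun p => dist (p.eval x) (p.eval y)

/-- The distance is a common-language formula, so the two means agree on it. -/
theorem nameDist_eq (b : Bool) (x y : Name Ls) :
    P.nameDist x y = P.mean b fun p => dist (p.eval x) (p.eval y) := by
  cases b
  · exact P.agree _ ⟨_, Definable.dist x y trivial trivial, rfl⟩
  · rfl

/-- The pseudometric on the names. -/
noncomputable abbrev nameMetric : PseudoMetricSpace (Name Ls) where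
  dist := P.nameDist
  dist_self x := by simpa [nameDist] using (P.isMean true).map_const 0
  dist_comm x y := by simp only [nameDist, dist_comm]
  dist_triangle x y z := by
    simp only [nameDist, ← map_add]
    exact (P.isMean true).mono (dist_mem_boundedFun x z)
      (Submodule.add_mem _ (dist_mem_boundedFun x y) (dist_mem_boundedFun y z))
      fun p => dist_triangle _ _ _

theorem mean_lip_sum (b : Bool) (C : NNReal) {k : ℕ} (h h' : Fin k → Name Ls) :
    (P.mean b fun p => C * ∑ i, dist (p.eval (h i)) (p.eval (h' i))) =
      C * ∑ i, P.nameDist (h i) (h' i) := by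
  have : (fun p : Point Ls b => (C : ℝ) * ∑ i, dist (p.eval (h i)) (p.eval (h' i))) =
      (C : ℝ) • ∑ i, fun p : Point Ls b => dist (p.eval (h i)) (p.eval (h' i)) := by
    ext p
    simp
  rw [this, map_smul, map_sum, smul_eq_mul]
  simp only [P.nameDist_eq b]

theorem lip_sum_mem_boundedFun (b : Bool) (C : NNReal) {k : ℕ} (h h' : Fin k → Name Ls) :
    (fun p : Point Ls b => (C : ℝ) * ∑ i, dist (p.eval (h i)) (p.eval (h' i))) ∈
      boundedFun (Point Ls b) := by
  have : (fun p : Point Ls b => (C : ℝ) * ∑ i, dist (p.eval (h i)) (p.eval (h' i))) =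
      (C : ℝ) • ∑ i, fun p : Point Ls b => dist (p.eval (h i)) (p.eval (h' i)) := by
    ext p
    simp
  rw [this]
  exact Submodule.smul_mem _ _ (Submodule.sum_mem _ fun i _ => dist_mem_boundedFun _ _)

theorem rel_mem_boundedFun {b : Bool} {R : S.Rel} (hR : R ∈ (Ls b).rels)
    (h : Fin (S.relArity R) → Name Ls) :
    (fun p : Point Ls b => p.1.rel ⟨R, hR⟩ fun i => p.eval (h i)) ∈ boundedFun (Point Ls b) :=
  ⟨1, fun p => abs_le.2 ⟨by linarith [(p.1.rel_mem ⟨R, hR⟩ fun i => p.eval (h i)).1],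
    (p.1.rel_mem ⟨R, hR⟩ fun i => p.eval (h i)).2⟩⟩

open Classical in
/-- The interpretation of the relation symbols on the names. -/
noncomputable def nameRel (R : S.Rel) (h : Fin (S.relArity R) → Name Ls) : ℝ :=
  if hR : ∃ b, R ∈ (Ls b).rels then
    P.mean hR.choose fun p => p.1.rel ⟨R, hR.choose_spec⟩ fun i => p.eval (h i)
  else 0

/-- The chosen side is immaterial: for a common relation symbol the two means agree. -/
theorem nameRel_eq {b : Bool} {R : S.Rel} (hR : R ∈ (Ls b).rels)
    (h : Fin (S.relArity R) → Name Ls) :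
    P.nameRel R h = P.mean b fun p => p.1.rel ⟨R, hR⟩ fun i => p.eval (h i) := by
  have hex : ∃ b, R ∈ (Ls b).rels := ⟨b, hR⟩
  have hag : ∀ (h₁ : R ∈ (Ls true).rels) (h₂ : R ∈ (Ls false).rels),
      (P.mean true fun p => p.1.rel ⟨R, h₁⟩ fun i => p.eval (h i)) =
        P.mean false fun p => p.1.rel ⟨R, h₂⟩ fun i => p.eval (h i) := fun h₁ h₂ =>
    P.agree _ ⟨_, Definable.rel (L := (Ls true ∩ Ls false).toLang) ⟨R, h₁, h₂⟩ h
      fun _ => trivial, rfl⟩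
  have hany : ∀ (c : Bool) (hc : R ∈ (Ls c).rels),
      (P.mean c fun p => p.1.rel ⟨R, hc⟩ fun i => p.eval (h i)) =
        P.mean b fun p => p.1.rel ⟨R, hR⟩ fun i => p.eval (h i) := by
    intro c hc
    cases b <;> cases c
    · rfl
    · exact hag hc hR
    · exact (hag hR hc).symm
    · rfl
  rw [nameRel, dif_pos hex]
  exact hany _ _

theorem nameDist_func_le {b : Bool} {F : S.Func} (hF : F ∈ (Ls b).funcs)
    (h h' : Fin (S.funcArity F) → Name Ls) :
    P.nameDist (.func F h) (.func F h') ≤ S.funcLip F * ∑ i, P.nameDist (h i) (h' i) := by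
  refine (P.nameDist_eq b _ _).trans_le (le_of_le_of_eq ?_ (P.mean_lip_sum b (S.funcLip F) h h'))
  refine (P.isMean b).mono (dist_mem_boundedFun _ _) (lip_sum_mem_boundedFun b _ h h') fun p => ?_
  exact (congrArg₂ dist (Name.eval_func p.1 p.2 hF h) (Name.eval_func p.1 p.2 hF h')).trans_le
    (p.1.func_lip ⟨F, hF⟩ _ _)

theorem nameRel_mem {b : Bool} {R : S.Rel} (hR : R ∈ (Ls b).rels)
    (h : Fin (S.relArity R) → Name Ls) : P.nameRel R h ∈ Set.Icc (0 : ℝ) 1 := by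
  rw [P.nameRel_eq hR]
  exact ⟨(P.isMean b).nonneg _ (rel_mem_boundedFun hR h) fun p => (p.1.rel_mem _ _).1,
    ((P.isMean b).mono (rel_mem_boundedFun hR h) (one_mem_boundedFun _)
      fun p => (p.1.rel_mem _ _).2).trans_eq (P.isMean b).map_one⟩

theorem nameRel_sub_le {b : Bool} {R : S.Rel} (hR : R ∈ (Ls b).rels)
    (h h' : Fin (S.relArity R) → Name Ls) :
    P.nameRel R h - P.nameRel R h' ≤ S.relLip R * ∑ i, P.nameDist (h i) (h' i) := by
  rw [P.nameRel_eq hR, P.nameRel_eq hR, ← map_sub]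
  refine le_of_le_of_eq ?_ (P.mean_lip_sum b (S.relLip R) h h')
  exact (P.isMean b).mono
    (Submodule.sub_mem _ (rel_mem_boundedFun hR h) (rel_mem_boundedFun hR h'))
    (lip_sum_mem_boundedFun b _ h h') fun p => p.1.rel_lip ⟨R, hR⟩ _ _

/-- The pre-structure on the names given by compatible means. -/
noncomputable def preModel : PreModel (Ls true ∪ Ls false).toLang where
  carrier := Name Ls
  metric := P.nameMetric
  dist_le_one x y := by
    refine ((P.isMean true).mono (dist_mem_boundedFun x y) (one_mem_boundedFun _) fun p =>
      p.1.dist_le_one _ _).trans_eq (P.isMean true).map_one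
  const c := .const c.1
  -- Function symbols act syntactically; evaluation of names at points makes this consistent with
  -- both sides.
  func F h := .func F.1 h
  func_lip := fun ⟨_, hF⟩ h h' =>
    (hF.elim (⟨true, ·⟩) (⟨false, ·⟩) : ∃ b, _ ∈ (Ls b).funcs).elim
      fun _ hb => P.nameDist_func_le hb h h'
  rel R h := P.nameRel R.1 h
  rel_mem := fun ⟨_, hR⟩ h =>
    (hR.elim (⟨true, ·⟩) (⟨false, ·⟩) : ∃ b, _ ∈ (Ls b).rels).elim
      fun _ hb => P.nameRel_mem hb h
  rel_lip := fun ⟨_, hR⟩ h h' =>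
    (hR.elim (⟨true, ·⟩) (⟨false, ·⟩) : ∃ b, _ ∈ (Ls b).rels).elim
      fun _ hb => P.nameRel_sub_le hb h h'

/-- The element of the completed structure denoted by a name. -/
noncomputable def element (x : Name Ls) : P.preModel.completion.carrier :=
  P.preModel.toCompletion x

/-- Names are closed under the symbols, so a term applied to names is again a name, the same one in
the completion and at all points. -/
theorem exists_name_value {b : Bool} {n : ℕ} (t : Term (Ls b).toLang n) (h : Fin n → Name Ls) :
    ∃ x : Name Ls, (t.incl (side_subset_union b)).value P.preModel.completion
        (fun i => P.element (h i)) = P.element x ∧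
      ∀ p : Point Ls b, t.value p.1 (fun i => p.eval (h i)) = p.eval x := by
  induction t with
  | var i => exact ⟨h i, rfl, fun p => rfl⟩
  | const c => exact ⟨.const c.1, rfl, fun p => (Name.eval_const p.1 p.2 c.2).symm⟩
  | func F ts ih =>
    choose x hx hp using ih
    refine ⟨.func F.1 x, ?_, fun p => ?_⟩
    · refine (congrArg (P.preModel.completion.func ⟨F.1, _⟩) (funext hx)).trans ?_
      exact P.preModel.completion_func ⟨F.1, (side_subset_union b).funcs F.2⟩ x
    · exact (congrArg (p.1.func F) (funext fun i => hp i p)).trans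
        (Name.eval_func p.1 p.2 F.2 x).symm

/-- The value of a formula in the structure on the names is the mean of its values. -/
def ValueEqMean {b : Bool} {n : ℕ} (φ : Formula (Ls b).toLang n) : Prop :=
  ∀ h : Fin n → Name Ls, (φ.incl (side_subset_union b)).value P.preModel.completion
    (fun i => P.element (h i)) = P.mean b fun p => φ.value p.1 fun i => p.eval (h i)

variable {P}

theorem ValueEqMean.smul {b : Bool} {n : ℕ} {φ : Formula (Ls b).toLang n} (hφ : P.ValueEqMean φ)
    (r : ℝ) : P.ValueEqMean (.smul r φ) := fun h =>
  (congrArg (r * ·) (hφ h)).trans (map_smul (P.mean b) r _).symm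

/-- The mean of the infimum is a lower bound by monotonicity. It is approached because a single
witness name comes within `1 / (n + 1)` of the infimum at all points simultaneously. -/
theorem ValueEqMean.inf {b : Bool} {n : ℕ} {φ : Formula (Ls b).toLang (n + 1)}
    (hφ : P.ValueEqMean φ) : P.ValueEqMean φ.inf := by
  intro h
  have hbdd := (φ.incl (side_subset_union b)).bddBelow_range P.preModel.completion
    fun x i => P.element (Fin.snoc (α := fun _ => Name Ls) h x i)
  have hval : (φ.inf.incl (side_subset_union b)).value P.preModel.completion
      (fun i => P.element (h i)) = ⨅ x, (φ.incl (side_subset_union b)).value P.preModel.completion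
        fun i => P.element (Fin.snoc (α := fun _ => Name Ls) h x i) :=
    P.preModel.value_completion_inf (φ.incl (side_subset_union b)) h
  have hsnoc : ∀ (x : Name Ls) (p : Point Ls b),
      (fun i => p.eval (Fin.snoc (α := fun _ => Name Ls) h x i)) =
        Fin.snoc (α := fun _ => p.1.carrier) (fun i => p.eval (h i)) (p.eval x) :=
    fun x p => Fin.comp_snoc p.eval h x
  rw [hval]
  simp only [hφ _] at hbdd ⊢
  refine le_antisymm (le_of_forall_pos_le_add fun ε hε => ?_) (le_ciInf fun x => ?_)
  · obtain ⟨n, hn⟩ := exists_nat_one_div_lt hε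
    refine (ciInf_le hbdd (.wit b φ h n)).trans (le_trans ?_ (add_le_add_right hn.le _))
    rw [← (P.isMean b).map_const (1 / ((n : ℝ) + 1)), ← map_add]
    refine (P.isMean b).mono (φ.value_mem_boundedFun _)
      (Submodule.add_mem _ (φ.inf.value_mem_boundedFun h) ⟨|1 / ((n : ℝ) + 1)|, fun _ => le_rfl⟩)
      fun p => ?_
    simp only [hsnoc]
    exact Name.value_eval_wit p.1 p.2 φ h n
  · refine (P.isMean b).mono (φ.inf.value_mem_boundedFun h) (φ.value_mem_boundedFun _) fun p => ?_
    simp only [hsnoc]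
    exact ciInf_le (φ.bddBelow_range p.1 fun y => Fin.snoc (fun i => p.eval (h i)) y) (p.eval x)

theorem ValueEqMean.sup {b : Bool} {n : ℕ} {φ : Formula (Ls b).toLang (n + 1)}
    (hφ : P.ValueEqMean φ) : P.ValueEqMean φ.sup := by
  intro h
  refine ((φ.incl (side_subset_union b)).value_sup_eq_neg_inf _ _).trans ?_
  simp only [φ.value_sup_eq_neg_inf]
  exact (congrArg (- ·) ((hφ.smul (-1)).inf h)).trans (map_neg (P.mean b) _).symm

variable (P)

/-- An analogue of Łoś's theorem, with linear means in place of an ultrafilter: all connectives are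
linear, so no multiplicativity is required. -/
theorem valueEqMean {b : Bool} {n : ℕ} (φ : Formula (Ls b).toLang n) : P.ValueEqMean φ := by
  induction φ with
  | one => exact fun h => (P.isMean b).map_one.symm
  | dist t₁ t₂ =>
    intro h
    obtain ⟨x₁, h₁, H₁⟩ := P.exists_name_value t₁ h
    obtain ⟨x₂, h₂, H₂⟩ := P.exists_name_value t₂ h
    refine (congrArg₂ dist h₁ h₂).trans ((P.preModel.completion_dist x₁ x₂).trans ?_)
    simp only [Formula.value, H₁, H₂]
    exact P.nameDist_eq b x₁ x₂
  | rel R ts =>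
    intro h
    choose x hx H using fun i => P.exists_name_value (ts i) h
    refine (congrArg (P.preModel.completion.rel ⟨R.1, _⟩) (funext hx)).trans
      ((P.preModel.completion_rel ⟨R.1, (side_subset_union b).rels R.2⟩ x).trans ?_)
    simp only [Formula.value, H]
    exact P.nameRel_eq R.2 x
  | add φ ψ h₁ h₂ =>
    exact fun h => (congrArg₂ (· + ·) (h₁ h) (h₂ h)).trans (map_add (P.mean b) _ _).symm
  | smul r φ ih => exact ih.smul r
  | inf φ ih => exact ih.inf
  | sup φ ih => exact ih.sup

theorem val_eq_mean {b : Bool} (σ : Sentence (Ls b).toLang) :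
    Sentence.val P.preModel.completion (σ.incl (side_subset_union b)) =
      P.mean b fun p => Sentence.val p.1 σ := by
  have := P.valueEqMean σ Fin.elim0
  simp only [Subsingleton.elim (fun i : Fin 0 => P.element (Fin.elim0 i)) Fin.elim0] at this
  refine this.trans (congrArg (P.mean b) (funext fun p => ?_))
  exact congrArg (σ.value p.1) (Subsingleton.elim _ _)

end CompatibleMeans

theorem Sentence.val_mem_boundedFun {b : Bool} (σ : Sentence (Ls b).toLang) :
    (fun p : Point Ls b => Sentence.val p.1 σ) ∈ boundedFun (Point Ls b) :=
  ⟨σ.bound, fun p => σ.abs_value_le p.1 _⟩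

theorem exists_interpolant (φ : Sentence (Ls true).toLang) (ψ : Sentence (Ls false).toLang)
    (hφψ : ValidLe (φ.incl (side_subset_union true)) (ψ.incl (side_subset_union false)))
    (ε : ℝ) (hε : 0 < ε) :
    ∃ θ : Sentence (Ls true ∩ Ls false).toLang,
      (∀ M, Sentence.val M φ - ε ≤ Sentence.val (M.reduct (inter_subset_side true)) θ) ∧
      ∀ M, Sentence.val (M.reduct (inter_subset_side false)) θ ≤ Sentence.val M ψ := by
  by_contra hcon
  have hconst : (fun _ : Point Ls true => ε) ∈ boundedFun _ := ⟨|ε|, fun _ => le_rfl⟩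
  obtain ⟨P, hP, hagree, hle⟩ := exists_isMean_pair (commonFormulas Ls)
    (by
      rintro _ ⟨G, hG, rfl⟩ b
      obtain ⟨C, hC⟩ := hG.bounded
      exact ⟨C, fun p => hC _ _⟩)
    ⟨_, Definable.one, rfl⟩
    (f := (fun p => Sentence.val p.1 φ) - fun _ => ε) (g := fun p => Sentence.val p.1 ψ)
    (Submodule.sub_mem _ φ.val_mem_boundedFun hconst) ψ.val_mem_boundedFun (by
      rintro _ ⟨G, hG, rfl⟩ ⟨h₁, h₂⟩
      exact hcon (exists_sentence_of_definable hG (fun M s => h₁ ⟨M, s⟩) fun M s => h₂ ⟨M, s⟩))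
  let Q : CompatibleMeans Ls := ⟨P, hP, hagree⟩
  -- In this structure the mean of `φ` is at most that of `ψ`, which is at most the mean of `φ`
  -- minus `ε`; this is where `ε > 0` is used.
  have h := hφψ Q.preModel.completion
  rw [Q.val_eq_mean, Q.val_eq_mean] at h
  rw [map_sub, (hP true).map_const] at hle
  have h' : P true (fun p => Sentence.val p.1 φ) ≤ P false fun p => Sentence.val p.1 ψ := h
  linarith

end NameModel

end AffineLogic

theorem mainTheorem11 {S : AffineLogic.LipLanguage.{u}} (L₁ L₂ : AffineLogic.Sublanguage S)
    (φ : AffineLogic.Sentence L₁.toLang) (ψ : AffineLogic.Sentence L₂.toLang)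
    (hφψ : AffineLogic.ValidLe
      (φ.incl (AffineLogic.Sublanguage.subset_union_left L₁ L₂))
      (ψ.incl (AffineLogic.Sublanguage.subset_union_right L₁ L₂)))
    (ε : ℝ) (hε : 0 < ε) :
    ∃ θ : AffineLogic.Sentence (L₁ ∩ L₂).toLang,
      AffineLogic.ValidLe (φ.subConst ε)
        (θ.incl (AffineLogic.Sublanguage.inter_subset_left L₁ L₂)) ∧
      AffineLogic.ValidLe
        (θ.incl (AffineLogic.Sublanguage.inter_subset_right L₁ L₂)) ψ := by
  obtain ⟨θ, h₁, h₂⟩ :=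
    AffineLogic.exists_interpolant (Ls := fun b => cond b L₁ L₂) φ ψ hφψ ε hε
  refine ⟨θ, fun M => ?_, fun M => ?_⟩
  · have hval : AffineLogic.Sentence.val M (φ.subConst ε) = AffineLogic.Sentence.val M φ - ε := by
      simp [AffineLogic.Sentence.val, AffineLogic.Formula.subConst, AffineLogic.Formula.value,
        sub_eq_add_neg]
    rw [hval]
    exact (h₁ M).trans_eq (θ.value_incl _ M _).symm
  · exact (θ.value_incl _ M _).trans_le (h₂ M)
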